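/- Let $\Omega\subseteq\mathbb R^n$ be a nonempty open set and write $D_j=-i\,\partial/\partial x_j$, $D^\alpha=D_1^{\alpha_1}\cdots D_n^{\alpha_n}$. A *non-quasianalytic weight* is a continuous increasing (i.e. nondecreasing) function $\omega:[0,\infty)\to[0,\infty)$ such that $(\alpha)$ there is $L>0$ with $\omega(2t)\le L(\omega(t)+1)$ for all $t\ge 0$; $(\beta)$ $\int_1^\infty \omega(t)t^{-2}\,dt<\infty$; $(\gamma)$ $\log t=o(\omega(t))$ as $t\to\infty$; $(\delta)$ $\varphi(t)=\omega(e^t)$ is convex. Put $\varphi^*(s)=\sup_{t\ge0}(st-\varphi(t))$ for $s\ge 0$. The weight satisfies *condition B-M-M* if there is $H\ge1$ with $2\omega(t)\le\omega(Ht)+H$ for all $t\ge0$. A system $P=(P_j(D))_{j=1}^N$ of linear partial differential operators with constant complex coefficients has *order $m$* if every $P_j$ has order $m$. For $\beta\in\mathbb N_0^N$ put $P^\beta=P_1(D)^{\beta_1}\circ\cdots\circ P_N(D)^{\beta_N}$. For $K\subset\Omega$ compact and $\lambda>0$ put $$p_{K,\lambda}(u)=\sup_{\alpha\in\mathbb N_0^n}\sup_{x\in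 K}|D^\alpha u(x)|\,e^{-\lambda\varphi^*(|\alpha|/\lambda)},\qquad p^P_{K,\lambda}(u)=\sup_{\beta\in\mathbb N_0^N}\|P^\beta u\|_{L^2(K)}\,e^{-\lambda\varphi^*(|\beta|m/\lambda)} .$$ Let $\mathcal E_{(\omega)}(\Omega)$ (Beurling case) be the set of $u\in C^\infty(\Omega)$ with $p_{K,\lambda}(u)<\infty$ for all compact $K\subset\Omega$ and all $\lambda>0$, and $\mathcal E_{\{\omega\}}(\Omega)$ (Roumieu case) the set of $u\in C^\infty(\Omega)$ such that for every compact $K\subset\Omega$ there is $\ell\in\mathbb N$, $\ell\ge1$, with $p_{K,1/\ell}(u)<\infty$. Define $\mathcal E^P_{(\omega)}(\Omega)$ and $\mathcal E^P_{\{\omega\}}(\Omega)$ in the same way with $p^P_{K,\lambda}$ in place of $p_{K,\lambda}$. The system $P$ satisfies *condition $(\mathscr C)$* (with respect to $\omega$ and $\Omega$) if for every $\lambda>0$ and every compact $K\subset\Omega$ the space $\mathcal E^P_{\omega,\lambda}(K)$ of all $u$ that are $C^\infty$ in the interior of $K$ and satisfy $p^P_{K,\lambda}(u)<\infty$ (the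 $L^2$-norms being taken over the interior of $K$) is a Banach space with the norm $p^P_{K,\lambda}$. Let $\omega$ be a non-quasianalytic weight satisfying condition B-M-M and let $P$ be a system of order $m$ satisfying condition $(\mathscr C)$. If $$\mathcal E^P_{(\omega)}(\Omega)\subseteq\mathcal E_{(\omega)}(\Omega)\qquad\text{or}\qquad \mathcal E^P_{\{\omega\}}(\Omega)\subseteq\mathcal E_{\{\omega\}}(\Omega),$$ then $P$ is elliptic, that is, there is $C>0$ such that $$|\xi|^m\le C\Big(1+\sum_{j=1}^N|P_j(\xi)|\Big)\qquad\text{for all }\xi\in\mathbb R^n .$$ -/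

import Mathlib

open MeasureTheory Set Filter
open scoped ContDiff

noncomputable section

namespace UltraIterates

/-! ### Weight functions -/

/-- Non-quasianalytic weight functions. Only the values of `w` on `[0, ∞)` matter. -/
structure IsNonQuasianalyticWeight (w : ℝ → ℝ) : Prop where
  continuousOn : ContinuousOn w (Ici 0)
  monotoneOn : MonotoneOn w (Ici 0)
  nonneg : ∀ t, 0 ≤ t → 0 ≤ w t
  /-- condition (α) -/
  doubling : ∃ L : ℝ, 0 < L ∧ ∀ t, 0 ≤ t → w (2 * t) ≤ L * (w t + 1)
  /-- condition (β): the integral of the nonnegative function `w(t)/t²` over `(1, ∞)` is finite -/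
  integrable : IntegrableOn (fun t => w t / t ^ 2) (Ioi 1)
  /-- condition (γ) -/
  log_isLittleO : Asymptotics.IsLittleO atTop Real.log w
  /-- condition (δ) -/
  convex : ConvexOn ℝ univ (fun t => w (Real.exp t))

/-- The growth condition B-M-M. -/
def ConditionBMM (w : ℝ → ℝ) : Prop :=
  ∃ H : ℝ, 1 ≤ H ∧ ∀ t, 0 ≤ t → 2 * w t ≤ w (H * t) + H

/-- The Young conjugate `φ*(s) = sup_{t ≥ 0} (s t - φ(t))` of `φ(t) = w(e^t)`. For a weight
function and `s ≥ 0`, the supremum is over a nonempty set that is bounded above. -/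
def youngConj (w : ℝ → ℝ) (s : ℝ) : ℝ :=
  sSup ((fun t => s * t - w (Real.exp t)) '' Ici 0)

/-- The number `exp (-λ φ*(k / λ))`, as an extended nonnegative real. -/
def decay (w : ℝ → ℝ) (lam : ℝ) (k : ℕ) : ENNReal :=
  ENNReal.ofReal (Real.exp (-(lam * youngConj w ((k : ℝ) / lam))))

/-! ### Operators with constant coefficients and their iterates -/

/-- `T₁^{β₁} ∘ T₂^{β₂} ∘ ⋯ ∘ T_N^{β_N}` for a finite family of maps `T` and a multi-index `β`. -/
def multiIterate {F : Type*} {N : ℕ} (T : Fin N → F → F) (β : Fin N → ℕ) : F → F :=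
  (List.ofFn fun j => (T j)^[β j]).foldr (fun f g => f ∘ g) id

/-- The length `|β|` of a multi-index. -/
def multiLength {N : ℕ} (β : Fin N → ℕ) : ℕ := ∑ j, β j

/-- `D_j = -i ∂/∂x_j`. -/
def partialD {n : ℕ} (j : Fin n) (u : EuclideanSpace ℝ (Fin n) → ℂ) :
    EuclideanSpace ℝ (Fin n) → ℂ :=
  fun x => -Complex.I * fderiv ℝ u x (EuclideanSpace.single j 1)

/-- `D^α = D_1^{α_1} ⋯ D_n^{α_n}`. -/
def multiD {n : ℕ} (α : Fin n → ℕ) :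
    (EuclideanSpace ℝ (Fin n) → ℂ) → EuclideanSpace ℝ (Fin n) → ℂ :=
  multiIterate partialD α

/-- The operator `P(D) = ∑_α c_α D^α` with symbol `P(ξ) = ∑_α c_α ξ^α`. -/
def diffOp {n : ℕ} (P : MvPolynomial (Fin n) ℂ) (u : EuclideanSpace ℝ (Fin n) → ℂ) :
    EuclideanSpace ℝ (Fin n) → ℂ :=
  fun x => ∑ α ∈ P.support, P.coeff α * multiD α u x

/-- The iterate `P^β = P_1(D)^{β_1} ∘ ⋯ ∘ P_N(D)^{β_N}` of a system. -/
def iterateOp {n N : ℕ} (P : Fin N → MvPolynomial (Fin n) ℂ) (β : Fin N → ℕ) :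
    (EuclideanSpace ℝ (Fin n) → ℂ) → EuclideanSpace ℝ (Fin n) → ℂ :=
  multiIterate (fun j => diffOp (P j)) β

/-- The system has order `m`: each of its operators has order `m`. -/
def HasOrder {n N : ℕ} (P : Fin N → MvPolynomial (Fin n) ℂ) (m : ℕ) : Prop :=
  ∀ j, (P j).totalDegree = m

/-- The symbol `P(ξ)` at a real point `ξ`. -/
def symbol {n : ℕ} (P : MvPolynomial (Fin n) ℂ) (ξ : EuclideanSpace ℝ (Fin n)) : ℂ :=
  MvPolynomial.eval (fun i => ((ξ i : ℝ) : ℂ)) P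

/-- Ellipticity of a system of order `m`: `|ξ|^m ≤ C (1 + ∑_j |P_j(ξ)|)` for all real `ξ`, where
`|ξ| = ∑_i |ξ_i|`. -/
def IsEllipticSystem {n N : ℕ} (P : Fin N → MvPolynomial (Fin n) ℂ) (m : ℕ) : Prop :=
  ∃ C : ℝ, ∀ ξ : EuclideanSpace ℝ (Fin n),
    (∑ i, |ξ i|) ^ m ≤ C * (1 + ∑ j, ‖symbol (P j) ξ‖)

/-! ### Spaces of ultradifferentiable functions

A function on an open set `U` is represented by a function on the whole space, of which only the
restriction to `U` is relevant. -/

/-- `sup_α sup_{x ∈ K} |D^α u(x)| exp (-λ φ*(|α| / λ))`. -/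
def derivSeminorm {n : ℕ} (w : ℝ → ℝ) (lam : ℝ) (K : Set (EuclideanSpace ℝ (Fin n)))
    (u : EuclideanSpace ℝ (Fin n) → ℂ) : ENNReal :=
  ⨆ α : Fin n → ℕ, ⨆ x ∈ K, ‖multiD α u x‖ₑ * decay w lam (multiLength α)

/-- `sup_β ‖P^β u‖_{L²(A)} exp (-λ φ*(|β| m / λ))`. -/
def iterateSeminorm {n N : ℕ} (w : ℝ → ℝ) (P : Fin N → MvPolynomial (Fin n) ℂ) (m : ℕ)
    (lam : ℝ) (A : Set (EuclideanSpace ℝ (Fin n))) (u : EuclideanSpace ℝ (Fin n) → ℂ) : ENNReal :=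
  ⨆ β : Fin N → ℕ,
    eLpNorm (iterateOp P β u) 2 (volume.restrict A) * decay w lam (multiLength β * m)

/-- `w`-ultradifferentiable functions of Beurling type on `Ω`. -/
def beurling {n : ℕ} (w : ℝ → ℝ) (Ω : Set (EuclideanSpace ℝ (Fin n))) :
    Set (EuclideanSpace ℝ (Fin n) → ℂ) :=
  {u | ContDiffOn ℝ ∞ u Ω ∧ ∀ K, IsCompact K → K ⊆ Ω →
    ∀ lam : ℝ, 0 < lam → derivSeminorm w lam K u < ⊤}

/-- `w`-ultradifferentiable functions of Roumieu type on `Ω`. -/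
def roumieu {n : ℕ} (w : ℝ → ℝ) (Ω : Set (EuclideanSpace ℝ (Fin n))) :
    Set (EuclideanSpace ℝ (Fin n) → ℂ) :=
  {u | ContDiffOn ℝ ∞ u Ω ∧ ∀ K, IsCompact K → K ⊆ Ω →
    ∃ l : ℕ, 0 < l ∧ derivSeminorm w (1 / (l : ℝ)) K u < ⊤}

/-- `w`-ultradifferentiable functions of Beurling type on `Ω` with respect to the iterates of the
system `P` of order `m`. -/
def iterateBeurling {n N : ℕ} (w : ℝ → ℝ) (P : Fin N → MvPolynomial (Fin n) ℂ) (m : ℕ)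
    (Ω : Set (EuclideanSpace ℝ (Fin n))) : Set (EuclideanSpace ℝ (Fin n) → ℂ) :=
  {u | ContDiffOn ℝ ∞ u Ω ∧ ∀ K, IsCompact K → K ⊆ Ω →
    ∀ lam : ℝ, 0 < lam → iterateSeminorm w P m lam K u < ⊤}

/-- `w`-ultradifferentiable functions of Roumieu type on `Ω` with respect to the iterates of the
system `P` of order `m`. -/
def iterateRoumieu {n N : ℕ} (w : ℝ → ℝ) (P : Fin N → MvPolynomial (Fin n) ℂ) (m : ℕ)
    (Ω : Set (EuclideanSpace ℝ (Fin n))) : Set (EuclideanSpace ℝ (Fin n) → ℂ) :=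
  {u | ContDiffOn ℝ ∞ u Ω ∧ ∀ K, IsCompact K → K ⊆ Ω →
    ∃ l : ℕ, 0 < l ∧ iterateSeminorm w P m (1 / (l : ℝ)) K u < ⊤}

/-! ### Condition (C) -/

/-- The space `ℰ^P_{w,λ}(K)`: smooth functions in the interior of the compact set `K` for which
the `λ`-norm of the iterates, with `L²`-norms over the interior of `K`, is finite. -/
def localIterateSpace {n N : ℕ} (w : ℝ → ℝ) (P : Fin N → MvPolynomial (Fin n) ℂ) (m : ℕ)
    (lam : ℝ) (K : Set (EuclideanSpace ℝ (Fin n))) : Set (EuclideanSpace ℝ (Fin n) → ℂ) :=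
  {u | ContDiffOn ℝ ∞ u (interior K) ∧ iterateSeminorm w P m lam (interior K) u < ⊤}

/-- Condition (C): for all `λ > 0` and all compact `K ⊆ Ω` the space `ℰ^P_{w,λ}(K)` is complete
in its norm, that is, every Cauchy sequence converges in the space. (The term `β = 0` is a multiple
of the `L²`-norm, so the norm vanishes exactly for the functions that are zero in the interior of
`K`, which represent the zero element.) -/
def ConditionC {n N : ℕ} (w : ℝ → ℝ) (P : Fin N → MvPolynomial (Fin n) ℂ) (m : ℕ)
    (Ω : Set (EuclideanSpace ℝ (Fin n))) : Prop :=
  ∀ lam : ℝ, 0 < lam → ∀ K, IsCompact K → K ⊆ Ω →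
    ∀ u : ℕ → EuclideanSpace ℝ (Fin n) → ℂ,
      (∀ k, u k ∈ localIterateSpace w P m lam K) →
      (∀ ε : ENNReal, 0 < ε → ∃ k₀, ∀ k ≥ k₀, ∀ l ≥ k₀,
        iterateSeminorm w P m lam (interior K) (u k - u l) < ε) →
      ∃ v ∈ localIterateSpace w P m lam K,
        Tendsto (fun k => iterateSeminorm w P m lam (interior K) (u k - v)) atTop (nhds 0)

end UltraIterates

end

noncomputable section

namespace UltraIterates

/-! ### Series of exponentials -/

/-! The proof is by contraposition, with an explicit counterexample. Set R^m = 1 + ∑|P_j(ξ)|. If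
ellipticity fails, there are frequencies ξ_k with a coordinate T_k arbitrarily large compared with
R_k, and B-M-M turns this into w(T_k) ≥ A w(R_k) for any prescribed A
(`exists_frequency_of_not_isEllipticSystem`). Take u = ∑ a_k e^{i⟨ξ_k, x - x₀⟩} with a_k decaying
slightly faster than every e^{-λ w(R_k)}. Iterates of P only see R_k, so Young's inequality puts u
in the Beurling class of the iterates (`expSum_mem_iterateBeurling`). At x₀ all phases cancel, so
pure derivatives of even order are bounded below by each single term
(`le_norm_multiD_single_expSum`); at the optimal order this is about a_k e^{μ w(T_k)}, which is
unbounded for every μ > 0 (`exists_le_pow_mul_exp_neg_youngConj`). Hence u is not even of Roumieu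
type, and this one function refutes both inclusions. -/

/-- The series `∑ c_k e^{i⟨ξ_k, x⟩}`. -/
def expSum {n : ℕ} (ξ : ℕ → EuclideanSpace ℝ (Fin n)) (c : ℕ → ℂ)
    (x : EuclideanSpace ℝ (Fin n)) : ℂ :=
  ∑' k, c k * Complex.exp (Complex.I * ((inner ℝ (ξ k) x : ℝ) : ℂ))

/-- Coefficients that are absolutely summable against all powers of the frequencies. -/
def RapidDecay {n : ℕ} (ξ : ℕ → EuclideanSpace ℝ (Fin n)) (c : ℕ → ℂ) : Prop :=
  ∀ r : ℕ, Summable fun k => ‖c k‖ * ‖ξ k‖ ^ r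

variable {n : ℕ} {ξ : ℕ → EuclideanSpace ℝ (Fin n)}

lemma norm_exp_I_inner (y x : EuclideanSpace ℝ (Fin n)) :
    ‖Complex.exp (Complex.I * ((inner ℝ y x : ℝ) : ℂ))‖ = 1 := by
  rw [mul_comm]; exact Complex.norm_exp_ofReal_mul_I _

lemma RapidDecay.summable_norm {c : ℕ → ℂ} (hc : RapidDecay ξ c) : Summable fun k => ‖c k‖ := by
  simpa using hc 0

lemma RapidDecay.summable {c : ℕ → ℂ} (hc : RapidDecay ξ c) (x : EuclideanSpace ℝ (Fin n)) :
    Summable fun k => c k * Complex.exp (Complex.I * ((inner ℝ (ξ k) x : ℝ) : ℂ)) := by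
  refine Summable.of_norm ?_
  simpa [norm_exp_I_inner] using hc.summable_norm

lemma RapidDecay.mul {c b : ℕ → ℂ} (hc : RapidDecay ξ c) (B : ℝ) (q : ℕ)
    (hb : ∀ k, ‖b k‖ ≤ B * ‖ξ k‖ ^ q) : RapidDecay ξ (fun k => b k * c k) := by
  intro r
  refine Summable.of_nonneg_of_le (fun k => by positivity) (fun k => ?_) ((hc (q + r)).mul_left B)
  calc ‖b k * c k‖ * ‖ξ k‖ ^ r = ‖b k‖ * (‖c k‖ * ‖ξ k‖ ^ r) := by rw [norm_mul]; ring
    _ ≤ (B * ‖ξ k‖ ^ q) * (‖c k‖ * ‖ξ k‖ ^ r) := by gcongr; exact hb k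
    _ = B * (‖c k‖ * ‖ξ k‖ ^ (q + r)) := by ring

lemma RapidDecay.add {c d : ℕ → ℂ} (hc : RapidDecay ξ c) (hd : RapidDecay ξ d) :
    RapidDecay ξ (fun k => c k + d k) := by
  intro r
  refine Summable.of_nonneg_of_le (fun k => by positivity) (fun k => ?_) ((hc r).add (hd r))
  rw [← add_mul]
  gcongr
  exact norm_add_le _ _

lemma RapidDecay.const_mul {c : ℕ → ℂ} (hc : RapidDecay ξ c) (a : ℂ) :
    RapidDecay ξ (fun k => a * c k) :=
  hc.mul ‖a‖ 0 fun k => by simp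

lemma RapidDecay.directional {c : ℕ → ℂ} (hc : RapidDecay ξ c)
    (v : EuclideanSpace ℝ (Fin n)) :
    RapidDecay ξ (fun k => (Complex.I * ((inner ℝ (ξ k) v : ℝ) : ℂ)) * c k) := by
  refine hc.mul ‖v‖ 1 fun k => ?_
  rw [norm_mul, Complex.norm_I, one_mul, Complex.norm_real, pow_one, mul_comm]
  exact norm_inner_le_norm _ _

lemma hasFDerivAt_const_mul_exp_inner (a : ℂ) (y x : EuclideanSpace ℝ (Fin n)) :
    HasFDerivAt (fun x => a * Complex.exp (Complex.I * ((inner ℝ y x : ℝ) : ℂ)))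
      ((a * Complex.exp (Complex.I * ((inner ℝ y x : ℝ) : ℂ)) * Complex.I) •
        (Complex.ofRealCLM.comp (innerSL ℝ y))) x := by
  have h1 : HasFDerivAt (fun x => ((inner ℝ y x : ℝ) : ℂ))
      (Complex.ofRealCLM.comp (innerSL ℝ y)) x :=
    (Complex.ofRealCLM.comp (innerSL ℝ y)).hasFDerivAt
  have h2 := ((h1.const_mul Complex.I).cexp).const_mul a
  exact h2.congr_fderiv (by rw [smul_smul, smul_smul])

lemma hasFDerivAt_expSum {c : ℕ → ℂ} (hc : RapidDecay ξ c) (x : EuclideanSpace ℝ (Fin n)) :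
    ∃ f' : EuclideanSpace ℝ (Fin n) →L[ℝ] ℂ, HasFDerivAt (expSum ξ c) f' x ∧
      ∀ v, f' v = expSum ξ (fun k => (Complex.I * ((inner ℝ (ξ k) v : ℝ) : ℂ)) * c k) x := by
  have hb : ∀ k x, ‖(c k * Complex.exp (Complex.I * ((inner ℝ (ξ k) x : ℝ) : ℂ)) * Complex.I) •
        (Complex.ofRealCLM.comp (innerSL ℝ (ξ k)))‖ ≤ ‖c k‖ * ‖ξ k‖ := by
    intro k x
    rw [norm_smul, norm_mul, norm_mul, norm_exp_I_inner, Complex.norm_I, mul_one, mul_one]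
    gcongr
    refine ContinuousLinearMap.opNorm_le_bound _ (norm_nonneg _) fun v => ?_
    simpa [Complex.norm_real] using norm_inner_le_norm (𝕜 := ℝ) (ξ k) v
  have hs : Summable fun k => ‖c k‖ * ‖ξ k‖ := by simpa using hc 1
  refine ⟨_, hasFDerivAt_tsum hs (fun k x => hasFDerivAt_const_mul_exp_inner (c k) (ξ k) x) hb
    (hc.summable 0) x, fun v => ?_⟩
  have hs' := Summable.of_norm_bounded hs fun k => hb k x
  have := (ContinuousLinearMap.apply ℝ ℂ v).map_tsum hs'
  simp only [ContinuousLinearMap.apply_apply] at this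
  rw [this]
  refine tsum_congr fun k => ?_
  simp
  ring

/-- A directional derivative is again such a series with rapidly decaying coefficients, so induction
on the order works once `c` is generalized. -/
lemma contDiff_expSum {c : ℕ → ℂ} (hc : RapidDecay ξ c) : ContDiff ℝ ∞ (expSum ξ c) := by
  rw [contDiff_infty]
  intro r
  induction r generalizing c with
  | zero =>
    refine contDiff_zero.2 (continuous_iff_continuousAt.2 fun x => ?_)
    obtain ⟨f', hf, -⟩ := hasFDerivAt_expSum hc x
    exact hf.continuousAt
  | succ r ih =>
    rw [Nat.cast_succ, contDiff_succ_iff_fderiv]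
    refine ⟨fun x => ?_, fun h => absurd h ?_, ?_⟩
    · obtain ⟨f', hf, -⟩ := hasFDerivAt_expSum hc x
      exact hf.differentiableAt
    · exact WithTop.coe_ne_top
    · refine contDiff_clm_apply_iff.2 fun v => ?_
      convert ih (hc.directional v) using 1
      ext x
      obtain ⟨f', hf, hv⟩ := hasFDerivAt_expSum hc x
      rw [hf.fderiv, hv]

lemma norm_expSum_le {c : ℕ → ℂ} (hc : RapidDecay ξ c) (x : EuclideanSpace ℝ (Fin n)) :
    ‖expSum ξ c x‖ ≤ ∑' k, ‖c k‖ := by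
  refine (norm_tsum_le_tsum_norm ?_).trans_eq ?_
  · simpa [norm_exp_I_inner] using hc.summable_norm
  · simp

/-- `A` acts on series of exponentials with frequencies `ξ_k` by multiplying the coefficients
with `b_k`. -/
def ActsAs (ξ : ℕ → EuclideanSpace ℝ (Fin n))
    (A : (EuclideanSpace ℝ (Fin n) → ℂ) → EuclideanSpace ℝ (Fin n) → ℂ) (b : ℕ → ℂ) : Prop :=
  ∀ c, RapidDecay ξ c → RapidDecay ξ (fun k => b k * c k) ∧
    A (expSum ξ c) = expSum ξ (fun k => b k * c k)

lemma ActsAs.id : ActsAs ξ id (fun _ => 1) := fun c hc => by simpa using hc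

lemma ActsAs.comp {A B : (EuclideanSpace ℝ (Fin n) → ℂ) → EuclideanSpace ℝ (Fin n) → ℂ}
    {a b : ℕ → ℂ} (hA : ActsAs ξ A a) (hB : ActsAs ξ B b) :
    ActsAs ξ (A ∘ B) (fun k => a k * b k) := by
  intro c hc
  obtain ⟨h1, h2⟩ := hB c hc
  obtain ⟨h3, h4⟩ := hA _ h1
  simp only [Function.comp_apply, mul_assoc]
  exact ⟨h3, by rw [h2, h4]⟩

lemma ActsAs.iterate {A : (EuclideanSpace ℝ (Fin n) → ℂ) → EuclideanSpace ℝ (Fin n) → ℂ}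
    {a : ℕ → ℂ} (hA : ActsAs ξ A a) (r : ℕ) : ActsAs ξ (A^[r]) (fun k => a k ^ r) := by
  induction r with
  | zero => simpa using ActsAs.id
  | succ r ih => rw [Function.iterate_succ]; simpa only [pow_succ] using ih.comp hA

lemma ActsAs.multiIterate {N : ℕ}
    {A : Fin N → (EuclideanSpace ℝ (Fin n) → ℂ) → EuclideanSpace ℝ (Fin n) → ℂ}
    {a : Fin N → ℕ → ℂ} (hA : ∀ j, ActsAs ξ (A j) (a j)) (β : Fin N → ℕ) :
    ActsAs ξ (multiIterate A β) (fun k => ∏ j, a j k ^ β j) := by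
  induction N with
  | zero => simpa [UltraIterates.multiIterate] using ActsAs.id
  | succ N ih =>
    have h := ((hA 0).iterate (β 0)).comp (ih (fun j => hA j.succ) (fun j => β j.succ))
    simp only [Fin.prod_univ_succ]
    convert h using 1
    simp [UltraIterates.multiIterate, List.ofFn_succ]

lemma actsAs_partialD (j : Fin n) :
    ActsAs ξ (partialD j) (fun k => ((ξ k j : ℝ) : ℂ)) := by
  intro c hc
  refine ⟨hc.mul 1 1 fun k => ?_, ?_⟩
  · rw [Complex.norm_real, one_mul, pow_one]
    exact PiLp.norm_apply_le _ _
  · ext x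
    obtain ⟨f', hf, hv⟩ := hasFDerivAt_expSum hc x
    rw [partialD, hf.fderiv, hv, expSum, expSum, ← tsum_mul_left]
    refine tsum_congr fun k => ?_
    rw [EuclideanSpace.inner_single_right]
    simp only [conj_trivial, one_mul]
    linear_combination (-((ξ k j : ℝ) : ℂ) * c k *
      Complex.exp (Complex.I * ((inner ℝ (ξ k) x : ℝ) : ℂ))) * Complex.I_mul_I

lemma actsAs_multiD (α : Fin n → ℕ) :
    ActsAs ξ (multiD α) (fun k => ∏ j, ((ξ k j : ℝ) : ℂ) ^ α j) :=
  ActsAs.multiIterate actsAs_partialD α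

lemma actsAs_sum {ι : Type*} (s : Finset ι) (a : ι → ℂ)
    {A : ι → (EuclideanSpace ℝ (Fin n) → ℂ) → EuclideanSpace ℝ (Fin n) → ℂ} {b : ι → ℕ → ℂ}
    (hA : ∀ i, ActsAs ξ (A i) (b i)) :
    ActsAs ξ (fun u x => ∑ i ∈ s, a i * A i u x) (fun k => ∑ i ∈ s, a i * b i k) := by
  classical
  induction s using Finset.induction_on with
  | empty =>
    intro c hc
    refine ⟨fun r => by simp, ?_⟩
    ext x
    simp [expSum]
  | insert i s hi ih =>
    intro c hc
    obtain ⟨h1, h2⟩ := ih c hc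
    obtain ⟨h3, h4⟩ := hA i c hc
    have h5 := h3.const_mul (a i)
    simp only [Finset.sum_insert hi, add_mul, mul_assoc]
    refine ⟨h5.add h1, ?_⟩
    ext x
    have h6 := congrFun h2 x
    simp only at h6
    rw [h6, h4, expSum, expSum, expSum, ← tsum_mul_left, ← Summable.tsum_add]
    · exact tsum_congr fun k => by ring
    · exact (h3.summable x).mul_left _
    · exact h1.summable x

lemma actsAs_diffOp (P : MvPolynomial (Fin n) ℂ) :
    ActsAs ξ (diffOp P) (fun k => symbol P (ξ k)) := by
  have h := actsAs_sum (ξ := ξ) P.support (fun α => P.coeff α) (A := fun α => multiD α)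
    (fun α => actsAs_multiD (ξ := ξ) α)
  simp only [symbol, MvPolynomial.eval_eq']
  exact h

lemma actsAs_iterateOp {N : ℕ} (P : Fin N → MvPolynomial (Fin n) ℂ) (β : Fin N → ℕ) :
    ActsAs ξ (iterateOp P β) (fun k => ∏ j, symbol (P j) (ξ k) ^ β j) :=
  ActsAs.multiIterate (fun j => actsAs_diffOp (P j)) β

/-! ### Estimates for weight functions -/

variable {w : ℝ → ℝ}

lemma IsNonQuasianalyticWeight.eventually_mul_log_le (hw : IsNonQuasianalyticWeight w) (A : ℝ) :
    ∀ᶠ t in atTop, A * Real.log t ≤ w t := by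
  have h := hw.log_isLittleO.def (c := 1 / (|A| + 1)) (by positivity)
  filter_upwards [h, eventually_ge_atTop 1] with t ht h1
  rw [Real.norm_of_nonneg (Real.log_nonneg h1),
    Real.norm_of_nonneg (hw.nonneg t (by linarith)), one_div, ← div_eq_inv_mul,
    le_div_iff₀ (by positivity)] at ht
  nlinarith [Real.log_nonneg h1, le_abs_self A]

lemma IsNonQuasianalyticWeight.bddAbove_youngConj (hw : IsNonQuasianalyticWeight w) (s : ℝ) :
    BddAbove ((fun t => s * t - w (Real.exp t)) '' Ici 0) := by
  obtain ⟨X, hX⟩ := eventually_atTop.1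
    (Real.tendsto_exp_atTop.eventually (hw.eventually_mul_log_le s))
  refine ⟨|s| * |X|, ?_⟩
  rintro _ ⟨t, ht, rfl⟩
  have ht : 0 ≤ t := ht
  simp only
  rcases le_total X t with h | h
  · have := hX t h
    rw [Real.log_exp] at this
    have : 0 ≤ |s| * |X| := by positivity
    linarith
  · have h1 : s * t ≤ |s| * |X| :=
      mul_le_mul (le_abs_self s) (h.trans (le_abs_self X)) ht (abs_nonneg s)
    linarith [hw.nonneg _ (Real.exp_pos t).le]

/-- Young's inequality at the point log R, which lies in the range t ≥ 0 of the supremum because R ≥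
1. -/
lemma IsNonQuasianalyticWeight.pow_mul_exp_neg_youngConj_le (hw : IsNonQuasianalyticWeight w)
    {R lam : ℝ} (hR : 1 ≤ R) (hlam : 0 < lam) (k : ℕ) :
    R ^ k * Real.exp (-(lam * youngConj w ((k : ℝ) / lam))) ≤ Real.exp (lam * w R) := by
  have hR0 : 0 < R := by linarith
  have h : (k : ℝ) / lam * Real.log R - w (Real.exp (Real.log R)) ≤ youngConj w ((k : ℝ) / lam) :=
    le_csSup (hw.bddAbove_youngConj _) ⟨Real.log R, Real.log_nonneg hR, rfl⟩
  rw [Real.exp_log hR0] at h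
  have h2 := mul_le_mul_of_nonneg_left h hlam.le
  have h3 : lam * ((k : ℝ) / lam * Real.log R - w R) = k * Real.log R - lam * w R := by
    field_simp
  have h4 : R ^ k = Real.exp (k * Real.log R) := by
    rw [Real.exp_nat_mul, Real.exp_log hR0]
  rw [h4, ← Real.exp_add, Real.exp_le_exp]
  linarith

lemma _root_.ConvexOn.exists_subgradient {f : ℝ → ℝ} (hf : ConvexOn ℝ univ f) (y : ℝ) :
    ∃ s, ∀ z, f y + s * (z - y) ≤ f z := by
  have hy : y ∈ interior (univ : Set ℝ) := by simp
  -- The right derivative dominates all slopes to the left of y and is dominated by all slopes to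
  -- the right.
  refine ⟨derivWithin f (Ioi y) y, fun z => ?_⟩
  rcases lt_trichotomy z y with h | rfl | h
  · have h1 := (hf.slope_le_leftDeriv_of_mem_interior (mem_univ z) hy h).trans
      (hf.leftDeriv_le_rightDeriv_of_mem_interior hy)
    rw [slope_def_field, div_le_iff₀ (by linarith)] at h1
    linarith
  · simp
  · have h1 := hf.rightDeriv_le_slope_of_mem_interior hy (mem_univ z) h
    rw [slope_def_field, le_div_iff₀ (by linarith)] at h1
    linarith

/-- Near-equality in Young's inequality: a subgradient s of φ at log T would be optimal, with order
μs. Rounding down to an even integer costs at most a factor T². -/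
lemma IsNonQuasianalyticWeight.exists_le_pow_mul_exp_neg_youngConj
    (hw : IsNonQuasianalyticWeight w) {T mu : ℝ} (hT : 1 ≤ T) (hmu : 0 < mu) :
    ∃ r : ℕ, Real.exp (mu * w T - 2 * Real.log T) ≤
      T ^ (2 * r) * Real.exp (-(mu * youngConj w (((2 * r : ℕ) : ℝ) / mu))) := by
  have hT0 : 0 < T := by linarith
  have hlog := Real.log_nonneg hT
  obtain ⟨s, hs⟩ := hw.convex.exists_subgradient (Real.log T)
  simp only [Real.exp_log hT0] at hs
  have hs0 : 0 ≤ s := by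
    have h1 := hs (Real.log T - 1)
    have h2 : w (Real.exp (Real.log T - 1)) ≤ w T := by
      refine hw.monotoneOn (Real.exp_pos _).le hT0.le ?_
      calc Real.exp (Real.log T - 1) ≤ Real.exp (Real.log T) := Real.exp_le_exp.2 (by linarith)
        _ = T := Real.exp_log hT0
    linarith
  set r := ⌊mu * s / 2⌋₊ with hr
  have hr1 : (r : ℝ) ≤ mu * s / 2 := Nat.floor_le (by positivity)
  have hr2 : mu * s / 2 < r + 1 := Nat.lt_floor_add_one _
  refine ⟨r, ?_⟩
  -- Since 2r/μ ≤ s and t ≥ 0, replacing 2r/μ by s only increases the supremum, and the supporting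
  -- line at log T bounds the result.
  have hy : youngConj w (((2 * r : ℕ) : ℝ) / mu) ≤ s * Real.log T - w T := by
    refine csSup_le ⟨_, 0, by simp, rfl⟩ ?_
    rintro _ ⟨t, ht, rfl⟩
    have ht : 0 ≤ t := ht
    have h1 := hs t
    have h2 : ((2 * r : ℕ) : ℝ) / mu ≤ s := by
      rw [div_le_iff₀ hmu]; push_cast; linarith
    have h3 := mul_le_mul_of_nonneg_right h2 ht
    simp only
    linarith
  have hy2 := mul_le_mul_of_nonneg_left hy hmu.le
  have h4 : T ^ (2 * r) = Real.exp (((2 * r : ℕ) : ℝ) * Real.log T) := by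
    rw [Real.exp_nat_mul, Real.exp_log hT0]
  rw [h4, ← Real.exp_add, Real.exp_le_exp]
  push_cast at hy2 ⊢
  have h5 := mul_le_mul_of_nonneg_right hr2.le hlog
  linarith

lemma ConditionBMM.iterate (hB : ConditionBMM w) (p : ℕ) :
    ∃ H C : ℝ, 1 ≤ H ∧ ∀ t, 0 ≤ t → 2 ^ p * w t ≤ w (H * t) + C := by
  obtain ⟨H, hH, h⟩ := hB
  induction p with
  | zero => exact ⟨1, 0, le_rfl, fun t _ => by simp⟩
  | succ p ih =>
    obtain ⟨G, C, hG, hC⟩ := ih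
    refine ⟨H * G, H + 2 * C, one_le_mul_of_one_le_of_one_le hH hG, fun t ht => ?_⟩
    have h1 := h (G * t) (by positivity)
    have h2 := hC t ht
    rw [pow_succ, mul_assoc H]
    linarith

lemma ConditionBMM.exists_mul_le (hB : ConditionBMM w) (hw : IsNonQuasianalyticWeight w) (A : ℝ) :
    ∃ H C : ℝ, 1 ≤ H ∧ ∀ t, 0 ≤ t → A * w t ≤ w (H * t) + C := by
  obtain ⟨p, hp⟩ := pow_unbounded_of_one_lt A (one_lt_two (α := ℝ))
  obtain ⟨H, C, hH, h⟩ := hB.iterate p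
  exact ⟨H, C, hH, fun t ht =>
    (mul_le_mul_of_nonneg_right hp.le (hw.nonneg t ht)).trans (h t ht)⟩

/-! ### Frequencies along which ellipticity fails -/

variable {N m : ℕ} {P : Fin N → MvPolynomial (Fin n) ℂ}

lemma norm_le_card_mul_of_forall_le {ξ : EuclideanSpace ℝ (Fin n)} {T : ℝ} (hT : 0 ≤ T)
    (h : ∀ j, |ξ j| ≤ T) : ‖ξ‖ ≤ n * T := by
  rw [EuclideanSpace.norm_eq]
  refine Real.sqrt_le_iff.2 ⟨by positivity, ?_⟩
  calc ∑ j, ‖ξ j‖ ^ 2 ≤ ∑ _j : Fin n, T ^ 2 :=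
        Finset.sum_le_sum fun j _ => pow_le_pow_left₀ (norm_nonneg _) (h j) 2
    _ = n * T ^ 2 := by simp
    _ ≤ (n * T) ^ 2 := by
        rw [mul_pow]
        gcongr
        exact_mod_cast Nat.le_self_pow two_ne_zero n

lemma exists_frequency_of_not_isEllipticSystem (hP : ¬ IsEllipticSystem P m)
    (hw : IsNonQuasianalyticWeight w) (hB : ConditionBMM w) {A : ℝ} (hA : 0 < A) :
    ∃ (ξ : EuclideanSpace ℝ (Fin n)) (i : Fin n) (R : ℝ), 1 ≤ R ∧
      R ^ m = 1 + ∑ j, ‖symbol (P j) ξ‖ ∧ 1 ≤ |ξ i| ∧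
      A * (w R + 1 + Real.log ‖ξ‖) ≤ w |ξ i| := by
  simp only [IsEllipticSystem, not_exists, not_forall, not_le] at hP
  -- For m = 0 the constant 1 already gives ellipticity; the m-th root below needs m ≠ 0.
  have hm : m ≠ 0 := by
    rintro rfl
    obtain ⟨ξ, hξ⟩ := hP 1
    have : 0 ≤ ∑ j, ‖symbol (P j) ξ‖ := Finset.sum_nonneg fun _ _ => norm_nonneg _
    simp only [pow_zero] at hξ
    linarith
  obtain ⟨H, C, hH, hHC⟩ := hB.exists_mul_le hw (2 * A)
  -- The budget for w(T): one half absorbs A w(R) by B-M-M with factor 2A, one quarter absorbs A log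
  -- T, and the last quarter absorbs the constants.
  obtain ⟨T₀, hT₀⟩ := eventually_atTop.1 ((hw.eventually_mul_log_le (4 * A)).and
    ((hw.eventually_mul_log_le 1).and (Real.tendsto_log_atTop.eventually_ge_atTop
      (4 * (A * (1 + Real.log n) + C / 2)))))
  -- The factor n passes from ∑|ξ_i| to the largest coordinate T; then H gives T ≥ HR and |T₀| gives
  -- T ≥ T₀.
  set B : ℝ := n * (H + |T₀|) with hBdef
  have hB0 : 0 ≤ B := by positivity
  obtain ⟨ξ, hξ⟩ := hP (B ^ m)
  set S := ∑ j, ‖symbol (P j) ξ‖ with hS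
  have hS0 : 0 ≤ S := Finset.sum_nonneg fun _ _ => norm_nonneg _
  set R : ℝ := (1 + S) ^ ((m : ℝ)⁻¹) with hR
  have hRm : R ^ m = 1 + S := Real.rpow_inv_natCast_pow (by linarith) hm
  have hR1 : 1 ≤ R := Real.one_le_rpow (by linarith) (by positivity)
  rw [← hRm, ← mul_pow] at hξ
  have hlt : B * R < ∑ i, |ξ i| :=
    lt_of_pow_lt_pow_left₀ m (Finset.sum_nonneg fun _ _ => abs_nonneg _) hξ
  have hpos : 0 < ∑ i, |ξ i| := lt_of_le_of_lt (by positivity) hlt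
  have hne : (Finset.univ : Finset (Fin n)).Nonempty := by
    by_contra h
    rw [Finset.not_nonempty_iff_eq_empty.1 h] at hpos
    simp at hpos
  obtain ⟨i, -, hi⟩ := Finset.exists_max_image Finset.univ (fun i => |ξ i|) hne
  have hn : 0 < (n : ℝ) := by exact_mod_cast Fin.pos i
  set T := |ξ i| with hT
  have hsum : ∑ j, |ξ j| ≤ n * T := by
    simpa using Finset.sum_le_card_nsmul Finset.univ (fun j => |ξ j|) T hi
  have hTR : (H + |T₀|) * R ≤ T := by
    have : n * ((H + |T₀|) * R) ≤ n * T := by rw [← mul_assoc]; exact hlt.le.trans hsum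
    exact le_of_mul_le_mul_left this hn
  have hHR : H * R ≤ T := by nlinarith [abs_nonneg T₀]
  have hT1 : 1 ≤ T := le_trans (by nlinarith) hHR
  have hTT : T₀ ≤ T := by nlinarith [abs_nonneg T₀, le_abs_self T₀]
  obtain ⟨h1, h2, h3⟩ := hT₀ T hTT
  have h4 := hHC R (by linarith)
  have h5 : w (H * R) ≤ w T :=
    hw.monotoneOn (show (0 : ℝ) ≤ H * R by nlinarith) (show (0 : ℝ) ≤ T by linarith) hHR
  have h6 : Real.log ‖ξ‖ ≤ Real.log n + Real.log T := by
    rw [← Real.log_mul hn.ne' (by linarith)]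
    refine Real.log_le_log ?_ (norm_le_card_mul_of_forall_le (by linarith)
      fun j => hi j (Finset.mem_univ j))
    have : T ≤ ‖ξ‖ := PiLp.norm_apply_le ξ i
    linarith
  have h7 := mul_le_mul_of_nonneg_left h6 hA.le
  refine ⟨ξ, i, R, hR1, hRm, hT1, ?_⟩
  nlinarith

/-! ### Membership of series of exponentials in the spaces of ultradifferentiable functions -/

lemma expSum_mem_iterateBeurling {ξ : ℕ → EuclideanSpace ℝ (Fin n)} {c : ℕ → ℂ}
    (hw : IsNonQuasianalyticWeight w) (hc : RapidDecay ξ c) {R : ℕ → ℝ} (hR : ∀ k, 1 ≤ R k)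
    (hPR : ∀ k j, ‖symbol (P j) (ξ k)‖ ≤ R k ^ m)
    (hs : ∀ lam : ℝ, 0 < lam → Summable fun k => ‖c k‖ * Real.exp (lam * w (R k)))
    (Ω : Set (EuclideanSpace ℝ (Fin n))) : expSum ξ c ∈ iterateBeurling w P m Ω := by
  refine ⟨(contDiff_expSum hc).contDiffOn, fun K hK _ lam hlam => ?_⟩
  -- A uniform bound suffices for the L² norms, as K has finite measure.
  have hfin : (volume.restrict K) univ ^ (ENNReal.toReal 2)⁻¹ *
      ENNReal.ofReal (∑' k, ‖c k‖ * Real.exp (lam * w (R k))) < ⊤ := by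
    refine ENNReal.mul_lt_top ?_ ENNReal.ofReal_lt_top
    refine ENNReal.rpow_lt_top_of_nonneg (by positivity) ?_
    rw [Measure.restrict_apply_univ]
    exact hK.measure_lt_top.ne
  refine lt_of_le_of_lt (iSup_le fun β => ?_) hfin
  obtain ⟨h1, h2⟩ := actsAs_iterateOp P β c hc
  rw [h2]
  refine (mul_le_mul_left (eLpNorm_le_of_ae_bound
    (Eventually.of_forall (norm_expSum_le h1))) _).trans ?_
  rw [mul_assoc, decay, ← ENNReal.ofReal_mul (tsum_nonneg fun _ => norm_nonneg _),
    ← tsum_mul_right]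
  refine mul_le_mul_right (ENNReal.ofReal_le_ofReal ?_) _
  have hle : ∀ k, ‖(∏ j, symbol (P j) (ξ k) ^ β j) * c k‖ *
      Real.exp (-(lam * youngConj w (((multiLength β * m : ℕ) : ℝ) / lam))) ≤
      ‖c k‖ * Real.exp (lam * w (R k)) := by
    intro k
    have hprod : ‖∏ j, symbol (P j) (ξ k) ^ β j‖ ≤ R k ^ (multiLength β * m) := by
      rw [norm_prod, multiLength, mul_comm, pow_mul, ← Finset.prod_pow_eq_pow_sum]
      refine Finset.prod_le_prod (fun _ _ => norm_nonneg _) fun j _ => ?_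
      rw [norm_pow]
      exact pow_le_pow_left₀ (norm_nonneg _) (hPR k j) _
    rw [norm_mul, mul_comm ‖∏ j, symbol (P j) (ξ k) ^ β j‖, mul_assoc]
    refine mul_le_mul_of_nonneg_left ?_ (norm_nonneg _)
    exact (mul_le_mul_of_nonneg_right hprod (Real.exp_pos _).le).trans
      (hw.pow_mul_exp_neg_youngConj_le (hR k) hlam _)
  exact Summable.tsum_le_tsum hle
    (Summable.of_nonneg_of_le (fun k => by positivity) hle (hs lam hlam)) (hs lam hlam)

/-- The coefficients carry the phases that cancel at x₀, and the even order makes every term of the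
differentiated series nonnegative, so no cancellation can occur. -/
lemma le_norm_multiD_single_expSum {ξ : ℕ → EuclideanSpace ℝ (Fin n)} {a : ℕ → ℝ}
    (ha : ∀ k, 0 ≤ a k) (x₀ : EuclideanSpace ℝ (Fin n))
    (hc : RapidDecay ξ fun k =>
      (a k : ℂ) * Complex.exp (-(Complex.I * ((inner ℝ (ξ k) x₀ : ℝ) : ℂ))))
    (i : Fin n) (r k : ℕ) :
    a k * |ξ k i| ^ (2 * r) ≤ ‖multiD (Pi.single i (2 * r)) (expSum ξ fun k =>
      (a k : ℂ) * Complex.exp (-(Complex.I * ((inner ℝ (ξ k) x₀ : ℝ) : ℂ)))) x₀‖ := by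
  obtain ⟨h1, h2⟩ := actsAs_multiD (ξ := ξ) (Pi.single i (2 * r)) _ hc
  have hterm : ∀ k, ((∏ j, ((ξ k j : ℝ) : ℂ) ^ (Pi.single i (2 * r) : Fin n → ℕ) j) *
      ((a k : ℂ) * Complex.exp (-(Complex.I * ((inner ℝ (ξ k) x₀ : ℝ) : ℂ))))) *
      Complex.exp (Complex.I * ((inner ℝ (ξ k) x₀ : ℝ) : ℂ)) =
      ((a k * |ξ k i| ^ (2 * r) : ℝ) : ℂ) := by
    intro k
    have hprod : (∏ j, ((ξ k j : ℝ) : ℂ) ^ (Pi.single i (2 * r) : Fin n → ℕ) j) =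
        ((ξ k i : ℝ) : ℂ) ^ (2 * r) := by
      rw [Finset.prod_eq_single i (fun j _ hj => by simp [Pi.single_eq_of_ne hj]) (by simp)]
      simp
    have habs : |ξ k i| ^ (2 * r) = ξ k i ^ (2 * r) := by rw [pow_mul, sq_abs, ← pow_mul]
    rw [hprod, habs, mul_assoc, mul_assoc, ← Complex.exp_add, neg_add_cancel, Complex.exp_zero]
    push_cast
    ring
  have hsum := h1.summable x₀
  rw [h2, expSum]
  simp only [hterm] at hsum ⊢
  rw [← Complex.ofReal_tsum, Complex.norm_real]
  exact ((Complex.summable_ofReal.1 hsum).le_tsum k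
    fun _ _ => mul_nonneg (ha _) (by positivity)).trans (le_abs_self _)

/-- A system that is not elliptic admits a function that is ultradifferentiable of Beurling type
with respect to its iterates, but not ultradifferentiable of Roumieu type. -/
lemma exists_mem_iterateBeurling_notMem_roumieu (hP : ¬ IsEllipticSystem P m)
    (hw : IsNonQuasianalyticWeight w) (hB : ConditionBMM w)
    {Ω : Set (EuclideanSpace ℝ (Fin n))} (hne : Ω.Nonempty) :
    ∃ u ∈ iterateBeurling w P m Ω, u ∉ roumieu w Ω := by
  obtain ⟨x₀, hx₀⟩ := hne
  -- The gain (k+1)² must outgrow the decay rate k of the coefficients, even after multiplication by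
  -- a small μ.
  choose ξ i R hR hRm hT hQ using fun k : ℕ =>
    exists_frequency_of_not_isEllipticSystem hP hw hB (A := ((k : ℝ) + 1) ^ 2) (by positivity)
  have hξT : ∀ k, |ξ k (i k)| ≤ ‖ξ k‖ := fun k => PiLp.norm_apply_le (ξ k) (i k)
  have hξ1 : ∀ k, 1 ≤ ‖ξ k‖ := fun k => (hT k).trans (hξT k)
  have hlog : ∀ k, 0 ≤ Real.log ‖ξ k‖ := fun k => Real.log_nonneg (hξ1 k)
  have hwR : ∀ k, 0 ≤ w (R k) := fun k => hw.nonneg _ (zero_le_one.trans (hR k))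
  set Q : ℕ → ℝ := fun k => w (R k) + 1 + Real.log ‖ξ k‖ with hQdef
  -- The growing factor k beats every fixed λ w(R_k) and r log‖ξ_k‖; the summand 1 in Q leaves
  -- e^{-k} for summability.
  set a : ℕ → ℝ := fun k => Real.exp (-(k * Q k)) with ha
  set c : ℕ → ℂ := fun k =>
    (a k : ℂ) * Complex.exp (-(Complex.I * ((inner ℝ (ξ k) x₀ : ℝ) : ℂ))) with hc
  have hca : ∀ k, ‖c k‖ = a k := by
    intro k
    have h := norm_exp_I_inner (ξ k) (-x₀)
    rw [inner_neg_right, Complex.ofReal_neg, mul_neg] at h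
    rw [hc]
    simp only
    rw [norm_mul, h, mul_one, Complex.norm_real, Real.norm_of_nonneg (Real.exp_pos _).le]
  have hrapid : RapidDecay ξ c := by
    intro r
    refine Summable.of_norm_bounded_eventually_nat Real.summable_exp_neg_nat ?_
    filter_upwards [eventually_ge_atTop r] with k hk
    have h0 : 0 < ‖ξ k‖ := zero_lt_one.trans_le (hξ1 k)
    have hp : ‖ξ k‖ ^ r = Real.exp (r * Real.log ‖ξ k‖) := by
      rw [Real.exp_nat_mul, Real.exp_log h0]
    rw [hca, hp, ha, ← Real.exp_add, Real.norm_of_nonneg (Real.exp_pos _).le, Real.exp_le_exp]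
    have hk' : (r : ℝ) ≤ k := by exact_mod_cast hk
    have h1 := mul_le_mul_of_nonneg_right hk' (hlog k)
    have h2 : 0 ≤ (k : ℝ) * w (R k) := mul_nonneg (Nat.cast_nonneg k) (hwR k)
    simp only [hQdef]
    linarith
  refine ⟨expSum ξ c, expSum_mem_iterateBeurling hw hrapid hR (fun k j => ?_)
    (fun lam _ => ?_) Ω, ?_⟩
  · rw [hRm]
    have := Finset.single_le_sum (f := fun j => ‖symbol (P j) (ξ k)‖)
      (fun _ _ => norm_nonneg _) (Finset.mem_univ j)
    linarith
  · refine Summable.of_norm_bounded_eventually_nat Real.summable_exp_neg_nat ?_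
    filter_upwards [eventually_ge_atTop ⌈lam⌉₊] with k hk
    have hk' : lam ≤ k := Nat.ceil_le.1 hk
    rw [hca, ha, ← Real.exp_add, Real.norm_of_nonneg (Real.exp_pos _).le, Real.exp_le_exp]
    have h1 := mul_le_mul_of_nonneg_right hk' (hwR k)
    have h2 : 0 ≤ (k : ℝ) * Real.log ‖ξ k‖ := mul_nonneg (Nat.cast_nonneg k) (hlog k)
    simp only [hQdef]
    linarith
  · rintro ⟨-, h⟩
    obtain ⟨l, hl, hD⟩ := h {x₀} isCompact_singleton (singleton_subset_iff.2 hx₀)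
    set mu : ℝ := 1 / (l : ℝ) with hmu
    have hmu0 : 0 < mu := by positivity
    set D := derivSeminorm w mu {x₀} (expSum ξ c) with hDdef
    have hbound : ∀ k, Real.exp (mu * w |ξ k (i k)| - 2 * Real.log |ξ k (i k)|) * a k
        ≤ D.toReal := by
      intro k
      obtain ⟨r, hr⟩ := hw.exists_le_pow_mul_exp_neg_youngConj (hT k) hmu0
      rw [← ENNReal.ofReal_le_iff_le_toReal hD.ne]
      have hle : ‖multiD (Pi.single (i k) (2 * r)) (expSum ξ c) x₀‖ₑ *
          decay w mu (multiLength (Pi.single (i k) (2 * r))) ≤ D :=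
        le_iSup_of_le (Pi.single (i k) (2 * r)) (le_iSup₂_of_le x₀ (mem_singleton x₀) le_rfl)
      refine le_trans ?_ hle
      rw [show multiLength (Pi.single (i k) (2 * r)) = 2 * r by simp [multiLength],
        decay, ← ofReal_norm, ← ENNReal.ofReal_mul (norm_nonneg _)]
      refine ENNReal.ofReal_le_ofReal ?_
      have h1 := le_norm_multiD_single_expSum (fun k => (Real.exp_pos _).le) x₀ hrapid (i k) r k
      calc _ ≤ _ := mul_le_mul_of_nonneg_right hr (Real.exp_pos _).le
        _ = a k * |ξ k (i k)| ^ (2 * r) *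
            Real.exp (-(mu * youngConj w (((2 * r : ℕ) : ℝ) / mu))) := by ring
        _ ≤ _ := mul_le_mul_of_nonneg_right h1 (Real.exp_pos _).le
    -- With this k the exponent is at least (μ(k+1)² - 2 - k) Q_k ≥ D, and e^x ≥ x + 1 contradicts
    -- the bound by D.
    obtain ⟨k, hk⟩ := exists_nat_ge ((2 + D.toReal) / mu)
    rw [div_le_iff₀ hmu0] at hk
    have h1 := hbound k
    rw [ha, ← Real.exp_add] at h1
    have h2 := Real.add_one_le_exp (mu * w |ξ k (i k)| - 2 * Real.log |ξ k (i k)| + -(k * Q k))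
    have h3 : Real.log |ξ k (i k)| ≤ Q k := by
      have := Real.log_le_log (zero_lt_one.trans_le (hT k)) (hξT k)
      simp only [hQdef]
      linarith [hwR k]
    have hQ1 : 1 ≤ Q k := by
      simp only [hQdef]
      linarith [hwR k, hlog k]
    have h4 := mul_le_mul_of_nonneg_left (hQ k) hmu0.le
    have hD0 : 0 ≤ D.toReal := ENNReal.toReal_nonneg
    have hk0 : (0 : ℝ) ≤ k := Nat.cast_nonneg k
    have h5 : D.toReal ≤ mu * ((k : ℝ) + 1) ^ 2 - 2 - k := by nlinarith
    have h6 : D.toReal ≤ (mu * ((k : ℝ) + 1) ^ 2 - 2 - k) * Q k := by nlinarith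
    have h7 : mu * (((k : ℝ) + 1) ^ 2 * Q k) ≤ mu * w |ξ k (i k)| := h4
    linarith

lemma beurling_subset_roumieu (Ω : Set (EuclideanSpace ℝ (Fin n))) :
    beurling w Ω ⊆ roumieu w Ω :=
  fun _ hu => ⟨hu.1, fun K hK hKΩ => ⟨1, one_pos, hu.2 K hK hKΩ _ (by norm_num)⟩⟩

lemma iterateBeurling_subset_iterateRoumieu (Ω : Set (EuclideanSpace ℝ (Fin n))) :
    iterateBeurling w P m Ω ⊆ iterateRoumieu w P m Ω :=
  fun _ hu => ⟨hu.1, fun K hK hKΩ => ⟨1, one_pos, hu.2 K hK hKΩ _ (by norm_num)⟩⟩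

end UltraIterates

end

theorem corollary2 {n N m : ℕ} (Ω : Set (EuclideanSpace ℝ (Fin n)))
    (hΩ : IsOpen Ω) (hne : Ω.Nonempty)
    (w : ℝ → ℝ) (hw : UltraIterates.IsNonQuasianalyticWeight w)
    (hBMM : UltraIterates.ConditionBMM w)
    (P : Fin N → MvPolynomial (Fin n) ℂ) (hP : UltraIterates.HasOrder P m)
    (hC : UltraIterates.ConditionC w P m Ω)
    (hincl :
      UltraIterates.iterateBeurling w P m Ω ⊆ UltraIterates.beurling w Ω ∨
      UltraIterates.iterateRoumieu w P m Ω ⊆ UltraIterates.roumieu w Ω) :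
    UltraIterates.IsEllipticSystem P m := by
  by_contra hell
  obtain ⟨u, hu, hnot⟩ :=
    UltraIterates.exists_mem_iterateBeurling_notMem_roumieu hell hw hBMM hne
  rcases hincl with h | h
  · exact hnot (UltraIterates.beurling_subset_roumieu Ω (h hu))
  · exact hnot (h (UltraIterates.iterateBeurling_subset_iterateRoumieu Ω hu))
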